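/- A crossed module $(H,G,\mu)$ is a homomorphism of groups $\mu\colon H\to G$ with an action of $G$ on the group $H$ such that $\mu({}^gh)=g\mu(h)g^{-1}$ and ${}^{\mu(h)}h'=hh'h^{-1}$. It is abelian when $G$ and $H$ are abelian and $G$ acts trivially on $H$. A morphism $(\alpha,\beta)\colon(H,G,\mu)\to(H',G',\mu')$ is a pair of homomorphisms $\alpha\colon H\to H'$, $\beta\colon G\to G'$ with $\mu'\alpha=\beta\mu$ and $\alpha({}^gh)={}^{\beta(g)}\alpha(h)$; it is a weak equivalence when the induced maps $\operatorname{Ker}\mu\to\operatorname{Ker}\mu'$ and $G/\operatorname{Im}\mu\to G'/\operatorname{Im}\mu'$ are isomorphisms. An action of $(H,G,\mu)$ on an abelian crossed module $(C,A,\nu)$ (written additively) consists of actions of the group $G$ on the groups $C$ and $A$ (and so of $H$ through $\mu$) for which $\nu$ is equivariant, together with a map $\xi\colon H\times A\to C$ such that $\nu\xi(h,a)={}^{\mu(h)}a-a$, $\xi(h,\nu(c))={}^{\mu(h)}c-c$, ${}^g\xi(h,a)=\xi({}^gh,{}^ga)$, $\xi(hh',a)={}^{\mu(h)}\xi(h',a)+\xi(h,a)$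 and $\xi(h,a+a')=\xi(h,a)+\xi(h,a')$. The nerve $N_*(H,G,\mu)$ is the simplicial group obtained as the nerve of the internal category in groups with group of objects $G$, group of arrows $H\rtimes G$, source $(h,g)\mapsto g$ and target $(h,g)\mapsto\mu(h)g$. An action of $(H,G,\mu)$ on $(C,A,\nu)$ induces an action of $N_*=N_*(H,G,\mu)$ on the simplicial abelian group $A_*=N_*(C,A,\nu)$, given on objects by the action of $G$ on $A$ and on arrows by $(h,g)\cdot(c,a)=({}^{\mu(h)g}c+\xi(h,{}^ga),{}^ga)$. Let $H_n((H,G,\mu),(C,A,\nu))$ be the $n$th homology group of the total complex of the first quadrant bicomplex whose $p$th column is $B_*(N_p)\otimes_{N_p}A_p$, with $B_*(N_p)$ the standard resolution of $\mathbb Z$ over $\mathbb Z[N_p]$, and whose horizontal differentials are the alternating sums of the maps induced by the face homomorphisms. **Proposition.** Let $(\alpha,\beta)\colon(H,G,\mu)\to(H',G',\mu')$ be a weak equivalence of crossed modules. Suppose that $(H',G',\mu')$ acts on an abelian crossed module $(C,A,\nu)$, and let $(H,G,\mu)$ act on $(C,A,\nu)$ through $(\alpha,\beta)$, that is, by ${}^gc={}^{\beta(g)}c$,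 ${}^ga={}^{\beta(g)}a$ and $(h,a)\mapsto\xi(\alpha(h),a)$. Then for every $n\ge 0$ the homomorphism induced by $(\alpha,\beta)$ is an isomorphism $$H_n((H,G,\mu),(C,A,\nu))\;\cong\;H_n((H',G',\mu'),(C,A,\nu)).$$ -/

import Mathlib

open CategoryTheory Opposite

universe u

/-- A crossed module `(H, G, μ)`: a group homomorphism `μ : H → G` together with an action
`act` of `G` on the group `H` (`ᵍh = act g h`), satisfying the precrossed module identity and
the Peiffer identity. -/
structure CrossedModule (H G : Type u) [Group H] [Group G] where
  μ : H →* G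
  act : G →* MulAut H
  map_act : ∀ (g : G) (h : H), μ (act g h) = g * μ h * g⁻¹
  peiffer : ∀ h h' : H, act (μ h) h' = h * h' * h⁻¹

/-- An abelian crossed module `(C, A, ν)`, written additively: both groups are abelian and the
action of `A` on `C` is trivial, so that all the data is a homomorphism `ν : C → A` (the precrossed
module identity and the Peiffer identity hold automatically). -/
structure AbelianCrossedModule (C A : Type u) [AddCommGroup C] [AddCommGroup A] where
  ν : C →+ A

namespace CrossedModule

section Basic

variable {H G H' G' : Type u} [Group H] [Group G] [Group H'] [Group G']

/-- A morphism `(α, β) : (H, G, μ) → (H', G', μ')` of crossed modules. -/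
structure Hom (X : CrossedModule H G) (X' : CrossedModule H' G') where
  α : H →* H'
  β : G →* G'
  comm : ∀ h : H, X'.μ (α h) = β (X.μ h)
  map_act : ∀ (g : G) (h : H), α (X.act g h) = X'.act (β g) (α h)

/-- The image of `μ` is a normal subgroup of `G`. -/
instance normal_range (X : CrossedModule H G) : X.μ.range.Normal where
  conj_mem := by
    rintro _ ⟨h, rfl⟩ g
    exact ⟨X.act g h, X.map_act g h⟩

namespace Hom

variable {X : CrossedModule H G} {X' : CrossedModule H' G'}

/-- The homomorphism `Ker μ → Ker μ'` induced by `α`. -/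
def kerMap (φ : Hom X X') : X.μ.ker →* X'.μ.ker :=
  (φ.α.comp X.μ.ker.subtype).codRestrict X'.μ.ker fun h => by
    have hh : X.μ h.1 = 1 := h.2
    simp [MonoidHom.mem_ker, φ.comm, hh]

/-- The homomorphism `G / Im μ → G' / Im μ'` induced by `β`. -/
def cokerMap (φ : Hom X X') : G ⧸ X.μ.range →* G' ⧸ X'.μ.range :=
  QuotientGroup.map X.μ.range X'.μ.range φ.β (by
    rintro _ ⟨h, rfl⟩
    exact ⟨φ.α h, φ.comm h⟩)

/-- A weak equivalence of crossed modules: a morphism inducing isomorphisms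
`Ker μ → Ker μ'` and `G / Im μ → G' / Im μ'`. -/
def IsWeakEquivalence (φ : Hom X X') : Prop :=
  Function.Bijective φ.kerMap ∧ Function.Bijective φ.cokerMap

end Hom

end Basic

/-! ### The nerve -/

section Nerve

variable {H G H' G' : Type u} [Group H] [Group G] [Group H'] [Group G']

/-- The simplices of the nerve of the internal category (in fact groupoid) in groups with group of
objects `G`, group of morphisms `H ⋊ G`, source `(h, g) ↦ g` and target `(h, g) ↦ μ h * g`.
For `ι = {0, …, n}`, an `n`-simplex is a string
`x₀ ← x₁ ← ⋯ ← xₙ` of composable arrows; here it is given by its objects `obj i = xᵢ` and by all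
the arrows `(arr i j, obj j) : xⱼ ⟶ xᵢ` between them (for `i > j`, the inverse of the composite).
The string `(h₁, …, hₙ, g)` in `H ⋊ (⋯ (H ⋊ G) ⋯)` is the simplex with `obj n = g` and
`arr (i - 1) i = hᵢ`, so that `arr i j = hᵢ₊₁ ⋯ hⱼ` for `i ≤ j`. -/
@[ext]
structure Nerve (X : CrossedModule H G) (ι : Type) where
  obj : ι → G
  arr : ι → ι → H
  tgt : ∀ i j, X.μ (arr i j) * obj j = obj i
  comp : ∀ i j k, arr i j * arr j k = arr i k

namespace Nerve

variable {X : CrossedModule H G} {X' : CrossedModule H' G'} {ι κ : Type}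

lemma arr_self (x : Nerve X ι) (i : ι) : x.arr i i = 1 := by
  simpa using x.comp i i i

lemma act_obj (x : Nerve X ι) (i j : ι) (h : H) :
    X.act (x.obj i) h = x.arr i j * X.act (x.obj j) h * (x.arr i j)⁻¹ := by
  rw [← x.tgt i j, map_mul, MulAut.mul_apply, X.peiffer]

/-- Pointwise multiplication of objects in `G` and of arrows in `H ⋊ G`. -/
instance : Mul (Nerve X ι) where
  mul x y :=
    { obj := fun i => x.obj i * y.obj i
      arr := fun i j => x.arr i j * X.act (x.obj j) (y.arr i j)
      tgt := fun i j => by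
        rw [map_mul, X.map_act, ← x.tgt i j, ← y.tgt i j]
        group
      comp := fun i j k => by
        rw [act_obj x j k, ← x.comp i j k, ← y.comp i j k, map_mul]
        group }

instance : One (Nerve X ι) where
  one := { obj := fun _ => 1, arr := fun _ _ => 1, tgt := by simp, comp := by simp }

instance : Inv (Nerve X ι) where
  inv x :=
    { obj := fun i => (x.obj i)⁻¹
      arr := fun i j => X.act (x.obj j)⁻¹ (x.arr i j)⁻¹
      tgt := fun i j => by
        rw [X.map_act, ← x.tgt i j, map_inv]
        group
      comp := fun i j k => by
        apply (X.act (x.obj k)).injective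
        rw [← x.tgt j k, ← x.comp i j k]
        simp only [map_mul, map_inv, mul_inv_rev, MulAut.mul_apply, MulAut.apply_inv_self]
        rw [← map_inv X.act, ← map_inv X.μ, X.peiffer]
        group }

@[simp] lemma mul_obj (x y : Nerve X ι) (i : ι) : (x * y).obj i = x.obj i * y.obj i := rfl

@[simp] lemma mul_arr (x y : Nerve X ι) (i j : ι) :
    (x * y).arr i j = x.arr i j * X.act (x.obj j) (y.arr i j) := rfl

@[simp] lemma one_obj (i : ι) : (1 : Nerve X ι).obj i = 1 := rfl

@[simp] lemma one_arr (i j : ι) : (1 : Nerve X ι).arr i j = 1 := rfl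

@[simp] lemma inv_obj (x : Nerve X ι) (i : ι) : (x⁻¹).obj i = (x.obj i)⁻¹ := rfl

@[simp] lemma inv_arr (x : Nerve X ι) (i j : ι) :
    (x⁻¹).arr i j = X.act (x.obj j)⁻¹ (x.arr i j)⁻¹ := rfl

instance : Group (Nerve X ι) :=
  Group.ofLeftAxioms
    (fun x y z => by ext <;> simp [mul_assoc])
    (fun x => by ext <;> simp)
    (fun x => by ext <;> simp)

/-- The simplicial operators of the nerve: the vertices are re-indexed along `f : κ → ι`. Thus the
face `dᵢ` omits the vertex `xᵢ` and the degeneracy `sᵢ` repeats it. -/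
def map (f : κ → ι) : Nerve X ι →* Nerve X κ where
  toFun x :=
    { obj := fun i => x.obj (f i)
      arr := fun i j => x.arr (f i) (f j)
      tgt := fun _ _ => x.tgt _ _
      comp := fun _ _ _ => x.comp _ _ _ }
  map_one' := rfl
  map_mul' _ _ := rfl

/-- The homomorphism of nerves induced by a morphism of crossed modules. -/
def ofHom (φ : Hom X X') (ι : Type) : Nerve X ι →* Nerve X' ι where
  toFun x :=
    { obj := fun i => φ.β (x.obj i)
      arr := fun i j => φ.α (x.arr i j)
      tgt := fun i j => by rw [φ.comm, ← map_mul, x.tgt]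
      comp := fun i j k => by rw [← map_mul, x.comp] }
  map_one' := by ext <;> simp
  map_mul' x y := by ext <;> simp [φ.map_act]

/-- An `n`-simplex of the nerve is the same thing as a tuple `(h₁, …, hₙ, g)`, the composable
string with last object `g` and arrows given by `h₁, …, hₙ`. -/
def stringEquiv (X : CrossedModule H G) (n : ℕ) :
    Nerve X (Fin (n + 1)) ≃ (Fin n → H) × G where
  toFun x := (fun i => x.arr i.castSucc i.succ, x.obj (Fin.last n))
  invFun p :=
    let k : Fin (n + 1) → H := Fin.reverseInduction 1 fun i r => p.1 i * r
    { obj := fun i => X.μ (k i) * p.2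
      arr := fun i j => k i * (k j)⁻¹
      tgt := fun i j => by simp
      comp := fun i j l => by group }
  left_inv x := by
    have hk : ∀ i, (Fin.reverseInduction (motive := fun _ => H) 1
        (fun i r => x.arr i.castSucc i.succ * r) i) = x.arr i (Fin.last n) := by
      intro i
      induction i using Fin.reverseInduction with
      | last => simp [arr_self]
      | cast i ih => rw [Fin.reverseInduction_castSucc, ih, x.comp]
    ext i
    · simp [hk, x.tgt]
    · rename_i j
      simp [hk, ← x.comp i j (Fin.last n)]
  right_inv p := by
    refine Prod.ext (funext fun i => ?_) ?_
    · simp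
    · simp

end Nerve

end Nerve

end CrossedModule

namespace AbelianCrossedModule

variable {C A : Type u} [AddCommGroup C] [AddCommGroup A]

/-- The nerve of an abelian crossed module `(C, A, ν)`, written additively: pairs `(w, c)`
of families of objects `w i : A` and of arrows `(c i j, w j) : w j ⟶ w i`. -/
def Nerve (M : AbelianCrossedModule C A) (ι : Type) : AddSubgroup ((ι → A) × (ι → ι → C)) where
  carrier := {p | (∀ i j, M.ν (p.2 i j) + p.1 j = p.1 i) ∧
    ∀ i j k, p.2 i j + p.2 j k = p.2 i k}
  zero_mem' := by simp
  add_mem' := by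
    rintro p q ⟨hp, hp'⟩ ⟨hq, hq'⟩
    refine ⟨fun i j => ?_, fun i j k => ?_⟩
    · simp only [Prod.fst_add, Prod.snd_add, Pi.add_apply, map_add, ← hp i j, ← hq i j]
      abel
    · simp only [Prod.snd_add, Pi.add_apply, ← hp' i j k, ← hq' i j k]
      abel
  neg_mem' := by
    rintro p ⟨hp, hp'⟩
    refine ⟨fun i j => ?_, fun i j k => ?_⟩
    · simp only [Prod.fst_neg, Prod.snd_neg, Pi.neg_apply, map_neg, ← hp i j]
      abel
    · simp only [Prod.snd_neg, Pi.neg_apply, ← hp' i j k]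
      abel

/-- The simplicial operators of the nerve: re-indexing of the vertices along `f : κ → ι`. -/
def Nerve.map (M : AbelianCrossedModule C A) {ι κ : Type} (f : κ → ι) :
    M.Nerve ι →+ M.Nerve κ where
  toFun p := ⟨(fun i => p.1.1 (f i), fun i j => p.1.2 (f i) (f j)),
    fun _ _ => p.2.1 _ _, fun _ _ _ => p.2.2 _ _ _⟩
  map_zero' := rfl
  map_add' _ _ := rfl

end AbelianCrossedModule

namespace CrossedModule

/-! ### Actions -/

section Action

variable {H G H' G' C A : Type u} [Group H] [Group G] [Group H'] [Group G']
  [AddCommGroup C] [AddCommGroup A]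

/-- An action of a crossed module `(H, G, μ)` on an abelian crossed module `(C, A, ν)`: actions of
the group `G` on `C` and on `A` by group automorphisms, for which `ν` is equivariant, and a map
`ξ : H × A → C` subject to the conditions below. (`H` acts on `C` and `A` through `μ`.) -/
structure Action (X : CrossedModule H G) (M : AbelianCrossedModule C A) where
  actC : G →* AddMonoid.End C
  actA : G →* AddMonoid.End A
  ξ : H → A → C
  map_ν : ∀ (g : G) (c : C), M.ν (actC g c) = actA g (M.ν c)
  ν_ξ : ∀ (h : H) (a : A), M.ν (ξ h a) = actA (X.μ h) a - a
  ξ_ν : ∀ (h : H) (c : C), ξ h (M.ν c) = actC (X.μ h) c - c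
  act_ξ : ∀ (g : G) (h : H) (a : A), actC g (ξ h a) = ξ (X.act g h) (actA g a)
  ξ_mul : ∀ (h h' : H) (a : A), ξ (h * h') a = actC (X.μ h) (ξ h' a) + ξ h a
  ξ_add : ∀ (h : H) (a a' : A), ξ h (a + a') = ξ h a + ξ h a'

namespace Action

variable {X : CrossedModule H G} {X' : CrossedModule H' G'} {M : AbelianCrossedModule C A}
  {ι κ : Type}

/-- The action induced along a morphism of crossed modules. -/
def pullback (a : Action X' M) (φ : Hom X X') : Action X M where
  actC := a.actC.comp φ.β
  actA := a.actA.comp φ.β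
  ξ h x := a.ξ (φ.α h) x
  map_ν g c := a.map_ν _ _
  ν_ξ h x := by simp [a.ν_ξ, φ.comm]
  ξ_ν h c := by simp [a.ξ_ν, φ.comm]
  act_ξ g h x := by simp [a.act_ξ, φ.map_act]
  ξ_mul h h' x := by simp [a.ξ_mul, φ.comm]
  ξ_add h x x' := a.ξ_add _ _ _

lemma ξ_zero (a : Action X M) (h : H) : a.ξ h 0 = 0 := by
  simpa using a.ξ_add h 0 0

lemma ξ_one (a : Action X M) (x : A) : a.ξ 1 x = 0 := by
  simpa using a.ξ_mul 1 1 x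

lemma actC_mul (a : Action X M) (g g' : G) (c : C) :
    a.actC (g * g') c = a.actC g (a.actC g' c) := by
  rw [map_mul]; rfl

lemma actA_mul (a : Action X M) (g g' : G) (x : A) :
    a.actA (g * g') x = a.actA g (a.actA g' x) := by
  rw [map_mul]; rfl

lemma actC_one (a : Action X M) (c : C) : a.actC 1 c = c := by
  rw [map_one]; rfl

lemma actA_one (a : Action X M) (x : A) : a.actA 1 x = x := by
  rw [map_one]; rfl

/-- A simplex of the nerve of `(H, G, μ)` acts on the nerve of `(C, A, ν)` pointwise: on objects
through the action of `G` on `A`, on arrows through the action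
`(h, g) • (c, w) = (^{μ(h)g} c + ξ(h, ^g w), ^g w)` of `H ⋊ G` on `C ⋊ A`, which is conjugation
in the semidirect product of the two crossed modules. -/
def nerveSMul (a : Action X M) (x : Nerve X ι) : M.Nerve ι →+ M.Nerve ι where
  toFun p := ⟨(fun i => a.actA (x.obj i) (p.1.1 i),
      fun i j => a.actC (x.obj i) (p.1.2 i j) + a.ξ (x.arr i j) (a.actA (x.obj j) (p.1.1 j))), by
    obtain ⟨⟨w, c⟩, hw, hc⟩ := p
    refine ⟨fun i j => ?_, fun i j k => ?_⟩
    · simp only at hw ⊢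
      rw [map_add, a.map_ν, a.ν_ξ, ← hw i j, map_add, ← a.actA_mul, x.tgt]
      abel
    · simp only at hw hc ⊢
      have h1 : a.ξ (x.arr i j) (a.actA (x.obj j) (w j)) =
          a.actC (x.obj i) (c j k) - a.actC (x.obj j) (c j k) +
          (a.actC (X.μ (x.arr i j)) (a.ξ (x.arr j k) (a.actA (x.obj k) (w k))) -
            a.ξ (x.arr j k) (a.actA (x.obj k) (w k))) +
          a.ξ (x.arr i j) (a.actA (x.obj k) (w k)) := by
        have h2 : a.actA (x.obj j) (w j) = M.ν (a.actC (x.obj j) (c j k)) +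
            (M.ν (a.ξ (x.arr j k) (a.actA (x.obj k) (w k))) + a.actA (x.obj k) (w k)) := by
          rw [a.map_ν, a.ν_ξ, sub_add_cancel, ← hw j k, map_add, ← a.actA_mul, x.tgt]
        rw [h2, a.ξ_add, a.ξ_add, a.ξ_ν, a.ξ_ν, ← a.actC_mul, x.tgt]
        abel
      rw [h1, ← hc i j k, map_add, ← x.comp i j k, a.ξ_mul]
      abel⟩
  map_zero' := by
    ext <;> simp [a.ξ_zero]
  map_add' p q := by
    ext
    · simp
    · simp [a.ξ_add]
      abel

/-- The action of the group of `n`-simplices of the nerve of `(H, G, μ)` on that of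
`(C, A, ν)`. -/
def nerveAct (a : Action X M) (ι : Type) : Nerve X ι →* AddMonoid.End (M.Nerve ι) where
  toFun := a.nerveSMul
  map_one' := AddMonoidHom.ext fun p => Subtype.ext <| Prod.ext
    (funext fun i => a.actA_one _)
    (funext fun i => funext fun j => by
      change a.actC 1 _ + a.ξ 1 _ = _
      rw [a.actC_one, a.ξ_one, add_zero]
      rfl)
  map_mul' x y := AddMonoidHom.ext fun p => Subtype.ext <| Prod.ext
    (funext fun i => a.actA_mul _ _ _)
    (funext fun i => funext fun j => by
      change a.actC (x.obj i * y.obj i) _ + a.ξ (x.arr i j * X.act (x.obj j) (y.arr i j)) _ =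
        a.actC (x.obj i) (a.actC (y.obj i) _ + a.ξ (y.arr i j) _) + a.ξ (x.arr i j) _
      simp only [Nerve.mul_obj, a.actA_mul, a.actC_mul, map_add, a.ξ_mul]
      rw [← a.act_ξ, ← a.actC_mul (X.μ _), x.tgt, add_assoc]
      rfl)

end Action

end Action

/-! ### Homology -/

section Homology

/-- A homomorphism of abelian groups as a linear map over (a copy in `Type u` of) `ℤ`. -/
def toLin {V W : Type u} [AddCommGroup V] [AddCommGroup W] (f : V →+ W) :
    V →ₗ[ULift.{u} ℤ] W where
  toFun := f
  map_add' := f.map_add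
  map_smul' r v := map_zsmul f r.down v

variable {H G H' G' C A : Type u} [Group H] [Group G] [Group H'] [Group G']
  [AddCommGroup C] [AddCommGroup A] {X : CrossedModule H G} {X' : CrossedModule H' G'}
  {M : AbelianCrossedModule C A}

namespace Action

/-- The nerve of `(C, A, ν)` as a representation over `ℤ` of the nerve of `(H, G, μ)`. -/
noncomputable def nerveRep (a : Action X M) (ι : Type) :
    Rep.{u} (ULift.{u} ℤ) (Nerve X ι) :=
  Rep.of (X := M.Nerve ι)
    { toFun x := toLin (a.nerveAct ι x)
      map_one' := by
        ext1 p
        exact congrArg (fun f : AddMonoid.End (M.Nerve ι) => f p) (map_one (a.nerveAct ι))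
      map_mul' x y := by
        ext1 p
        exact congrArg (fun f : AddMonoid.End (M.Nerve ι) => f p) (map_mul (a.nerveAct ι) x y) }

/-- The simplicial operators of the nerve of `(C, A, ν)` are equivariant. -/
noncomputable def nerveRepMap (a : Action X M) {ι κ : Type} (f : κ → ι) :
    a.nerveRep ι ⟶ Rep.res (Nerve.map f) (a.nerveRep κ) :=
  Rep.ofHom ⟨toLin (AbelianCrossedModule.Nerve.map M f), fun _ => rfl⟩

/-- The chain map `B_*(Nₚ) ⊗_{Nₚ} Aₚ → B_*(N_q) ⊗_{N_q} A_q` induced by a simplicial operator, where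
`N` and `A` are the nerves of `(H, G, μ)` and of `(C, A, ν)`. Here `inhomogeneousChains` is the
standard complex `B_*(Nₚ) ⊗_{Nₚ} Aₚ` with `B_m(Nₚ) ⊗_{Nₚ} Aₚ = ℤ[Nₚ^m] ⊗ Aₚ`, where
`a ⊗ (g₁, …, g_m)` stands for `(1 ⊗ g₁ ⊗ ⋯ ⊗ g_m) ⊗ a`. -/
noncomputable def barOp (a : Action X M) {ι κ : Type} (f : κ → ι) :
    groupHomology.inhomogeneousChains (a.nerveRep ι) ⟶
      groupHomology.inhomogeneousChains (a.nerveRep κ) :=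
  groupHomology.chainsMap (Nerve.map f) (a.nerveRepMap f)

lemma barOp_id (a : Action X M) (ι : Type) : a.barOp (id : ι → ι) = 𝟙 _ :=
  groupHomology.chainsMap_id

lemma barOp_comp (a : Action X M) {ι κ τ : Type} (f : κ → ι) (g : τ → κ) :
    a.barOp (f ∘ g) = a.barOp f ≫ a.barOp g :=
  groupHomology.chainsMap_comp (Nerve.map f) (Nerve.map g) (a.nerveRepMap f) (a.nerveRepMap g)

/-- The simplicial chain complex `p ↦ B_*(Nₚ) ⊗_{Nₚ} Aₚ`, where `N` and `A` are the nerves of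
`(H, G, μ)` and of `(C, A, ν)`. -/
noncomputable def bar (a : Action X M) :
    SimplicialObject (ChainComplex (ModuleCat.{u} (ULift.{u} ℤ)) ℕ) where
  obj n := groupHomology.inhomogeneousChains (a.nerveRep (Fin (n.unop.len + 1)))
  map f := a.barOp f.unop.toOrderHom
  map_id n := a.barOp_id (Fin (n.unop.len + 1))
  map_comp f g := a.barOp_comp f.unop.toOrderHom g.unop.toOrderHom

/-- The bicomplex `B(N, A)`: in column `p` it has the complex `B_*(Nₚ) ⊗_{Nₚ} Aₚ`, and its
horizontal differentials are the alternating sums of the face maps. -/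
noncomputable def bicomplex (a : Action X M) :
    HomologicalComplex₂ (ModuleCat.{u} (ULift.{u} ℤ)) (ComplexShape.down ℕ)
      (ComplexShape.down ℕ) :=
  (AlgebraicTopology.alternatingFaceMapComplex _).obj a.bar

/-- The total complex of the bicomplex `B(N, A)`. -/
noncomputable def tot (a : Action X M) : ChainComplex (ModuleCat.{u} (ULift.{u} ℤ)) ℕ :=
  a.bicomplex.total (ComplexShape.down ℕ)

/-- The `n`-th homology group `Hₙ((H, G, μ), (C, A, ν))` of the crossed module `(H, G, μ)` with
coefficients in the abelian crossed module `(C, A, ν)` on which it acts. -/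
noncomputable def homology (a : Action X M) (n : ℕ) : ModuleCat.{u} (ULift.{u} ℤ) :=
  a.tot.homology n

/-- The identity of the nerve of `(C, A, ν)`, as an equivariant map from the nerve with the induced
action to the restriction of the nerve with the given action. -/
noncomputable def pullbackRepMap (a : Action X' M) (φ : Hom X X') (ι : Type) :
    (a.pullback φ).nerveRep ι ⟶ Rep.res (Nerve.ofHom φ ι) (a.nerveRep ι) :=
  Rep.ofHom ⟨LinearMap.id, fun _ => rfl⟩

/-- The chain map `B_*(Nₚ) ⊗_{Nₚ} Aₚ → B_*(N'ₚ) ⊗_{N'ₚ} Aₚ` induced by a morphism of crossed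
modules. -/
noncomputable def barPullback (a : Action X' M) (φ : Hom X X') (ι : Type) :
    groupHomology.inhomogeneousChains ((a.pullback φ).nerveRep ι) ⟶
      groupHomology.inhomogeneousChains (a.nerveRep ι) :=
  groupHomology.chainsMap (Nerve.ofHom φ ι) (a.pullbackRepMap φ ι)

lemma barPullback_naturality (a : Action X' M) (φ : Hom X X') {ι κ : Type} (f : κ → ι) :
    (a.pullback φ).barOp f ≫ a.barPullback φ κ = a.barPullback φ ι ≫ a.barOp f :=
  (groupHomology.chainsMap_comp (Nerve.map f) (Nerve.ofHom φ κ) ((a.pullback φ).nerveRepMap f)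
    (a.pullbackRepMap φ κ)).symm.trans
    (groupHomology.chainsMap_comp (Nerve.ofHom φ ι) (Nerve.map f) (a.pullbackRepMap φ ι)
      (a.nerveRepMap f))

/-- The map of simplicial chain complexes induced by a morphism of crossed modules. -/
noncomputable def barMap (a : Action X' M) (φ : Hom X X') : (a.pullback φ).bar ⟶ a.bar where
  app n := a.barPullback φ (Fin (n.unop.len + 1))
  naturality _ _ f := a.barPullback_naturality φ f.unop.toOrderHom

/-- The map of bicomplexes induced by a morphism of crossed modules. -/
noncomputable def bicomplexMap (a : Action X' M) (φ : Hom X X') :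
    (a.pullback φ).bicomplex ⟶ a.bicomplex :=
  (AlgebraicTopology.alternatingFaceMapComplex _).map (a.barMap φ)

/-- The map of total complexes induced by a morphism of crossed modules. -/
noncomputable def totMap (a : Action X' M) (φ : Hom X X') : (a.pullback φ).tot ⟶ a.tot :=
  HomologicalComplex₂.total.map (a.bicomplexMap φ) (ComplexShape.down ℕ)

/-- The homomorphism `Hₙ((H, G, μ), (C, A, ν)) → Hₙ((H', G', μ'), (C, A, ν))` induced by a morphism
of crossed modules `(H, G, μ) → (H', G', μ')`, where `(H, G, μ)` acts through this morphism. -/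
noncomputable def homologyMap (a : Action X' M) (φ : Hom X X') (n : ℕ) :
    (a.pullback φ).homology n →+ a.homology n :=
  (HomologicalComplex.homologyMap (a.totMap φ) n).hom.toAddMonoidHom

end Action

end Homology

end CrossedModule

/-! A weak equivalence is an equivalence between the groupoids underlying the two crossed modules:
`Ker` gives automorphisms and `G / Im` gives isomorphism classes. A quasi-inverse exists after
choices, but it need not be compatible with the group laws, so it does not act on the columns of the
bicomplex.

It does act on the rows. In a fixed bar degree `q` the row is `p ↦ ℤ[Nₚ^q] ⊗ Aₚ`, and its faces and
degeneracies re-index vertices separately in each of the `q` entries and in the coefficient. The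
multiplication of `Nₚ` and its action on `Aₚ` enter only the vertical differential. Hence a row
depends only on the simplicial set `N` and the simplicial group `A`; the quasi-inverse gives a map
back (`Nerve.exists_inverse`), the natural isomorphisms give simplicial homotopies
(`rowGaugeHomotopy`), and the induced map on each row is a homotopy equivalence
(`exists_rowHomotopyEquiv`).

The inverses and homotopies on rows are not maps of bicomplexes, so what is passed to the total
complex is acyclicity of the mapping cone, in the elementwise form `ConeExact`. In the first
quadrant, cone-acyclic rows give a cone-acyclic total map (`coneExact_total_map`), by clearing one
row at a time from the top; this forces an isomorphism on homology. -/

/-! ### Acyclic mapping cones in terms of generalized elements -/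

section ConeExact

open CategoryTheory.Limits

variable {V : Type*} [Category V] [Preadditive V]

/-- Elementwise acyclicity of the mapping cone of `f`: every relative cycle `(x, w)` (with `x` in
degree `n - 1`, absent when `n = 0`) is a relative boundary. -/
def ConeExact {K L : ChainComplex V ℕ} (f : K ⟶ L) : Prop :=
  ∀ (n m l : ℕ) (_ : n - 1 = m) (_ : m - 1 = l) {T : V} (x : T ⟶ K.X m) (w : T ⟶ L.X n),
    (n = 0 → x = 0) → x ≫ K.d m l = 0 → x ≫ f.f m = w ≫ L.d n m →
    ∃ (x' : T ⟶ K.X n) (w' : T ⟶ L.X (n + 1)),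
      x' ≫ K.d n m = x ∧ x' ≫ f.f n - w = w' ≫ L.d (n + 1) n

lemma coneExact_of_homotopyEquiv {K L : ChainComplex V ℕ} (e : HomotopyEquiv K L) :
    ConeExact e.hom := by
  rintro n m l hm hl T x w hx₀ hx hxw
  have hK : ∀ i j, i - 1 = j → e.hom.f i ≫ e.inv.f i = K.d i j ≫ e.homotopyHomInvId.hom j i +
      e.homotopyHomInvId.hom i (i + 1) ≫ K.d (i + 1) i + 𝟙 _ := by
    rintro i _ rfl
    have h := e.homotopyHomInvId.comm i
    rwa [dNext_nat, prevD_eq _ (show (ComplexShape.down ℕ).Rel (i + 1) i from rfl)] at h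
  have hL : ∀ i j, i - 1 = j → e.inv.f i ≫ e.hom.f i = L.d i j ≫ e.homotopyInvHomId.hom j i +
      e.homotopyInvHomId.hom i (i + 1) ≫ L.d (i + 1) i + 𝟙 _ := by
    rintro i _ rfl
    have h := e.homotopyInvHomId.comm i
    rwa [dNext_nat, prevD_eq _ (show (ComplexShape.down ℕ).Rel (i + 1) i from rfl)] at h
  obtain ⟨x₀, h₀⟩ : ∃ x₀ : T ⟶ K.X n, x₀ ≫ K.d n m = x := by
    rcases n with _ | n
    · exact ⟨0, by simp [hx₀ rfl]⟩
    · obtain rfl : n = m := by omega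
      -- The homotopy writes the cycle `x` as its image under the round trip minus a boundary, and
      -- that image is the boundary of `w ≫ e.inv` because `x ≫ e.hom` is the boundary of `w`.
      refine ⟨w ≫ e.inv.f (n + 1) - x ≫ e.homotopyHomInvId.hom n (n + 1), ?_⟩
      have h := x ≫= hK n l hl
      rw [reassoc_of% hxw] at h
      simp only [Preadditive.comp_add, reassoc_of% hx, zero_comp, zero_add, Category.comp_id] at h
      rw [Preadditive.sub_comp, Category.assoc, Category.assoc, e.inv.comm, h]
      abel
  -- The error `z` is a cycle, so adding `z ≫ e.inv` to `x₀` leaves its boundary unchanged and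
  -- corrects the image by a cycle homologous to `z`.
  obtain ⟨z, hz'⟩ : ∃ z, z = w - x₀ ≫ e.hom.f n := ⟨_, rfl⟩
  have hz : z ≫ L.d n m = 0 := by
    rw [hz', Preadditive.sub_comp, Category.assoc, e.hom.comm, reassoc_of% h₀, hxw, sub_self]
  refine ⟨x₀ + z ≫ e.inv.f n, z ≫ e.homotopyInvHomId.hom n (n + 1), ?_, ?_⟩
  · rw [Preadditive.add_comp, Category.assoc, e.inv.comm, reassoc_of% hz, zero_comp, add_zero, h₀]
  · have h := z ≫= hL n m hm
    rw [Preadditive.comp_add, Preadditive.comp_add, reassoc_of% hz, zero_comp, zero_add,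
      Category.comp_id] at h
    rw [Preadditive.add_comp, Category.assoc z, h, Category.assoc, hz']
    abel

/-- Injectivity is cone exactness in degree `n + 1`, surjectivity the case `x = 0` in degree `n`. As
the source `T` of the elements is arbitrary, no refinement of it is needed. -/
lemma ConeExact.isIso_homologyMap {V : Type*} [Category V] [Abelian V] {K L : ChainComplex V ℕ}
    {f : K ⟶ L} (hf : ConeExact f) (n : ℕ) : IsIso (HomologicalComplex.homologyMap f n) := by
  have hnext : (ComplexShape.down ℕ).next n = n - 1 := by
    rcases n with _ | n
    · exact ChainComplex.next_nat_zero
    · exact ChainComplex.next_nat_succ n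
  have : Mono (HomologicalComplex.homologyMap f n) := by
    rw [HomologicalComplex.mono_homologyMap_iff_up_to_refinements f (n + 1) n (n - 1)
      (ChainComplex.prev ℕ n) hnext]
    intro T x hx y hxy
    obtain ⟨x', _, h, _⟩ := hf (n + 1) n _ rfl rfl x y (by simp) hx hxy
    exact ⟨T, 𝟙 T, inferInstance, x', by rw [Category.id_comp]; exact h.symm⟩
  have : Epi (HomologicalComplex.homologyMap f n) := by
    rw [HomologicalComplex.epi_homologyMap_iff_up_to_refinements f (n + 1) n (n - 1)
      (ChainComplex.prev ℕ n) hnext]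
    intro T y hy
    obtain ⟨x', w', h, h'⟩ := hf n _ _ rfl rfl 0 y (fun _ => rfl) zero_comp (by rw [zero_comp, hy])
    refine ⟨T, 𝟙 T, inferInstance, x', h, -w', ?_⟩
    rw [Category.id_comp, Preadditive.neg_comp, ← h']
    abel
  exact isIso_of_mono_of_epi _

end ConeExact

/-! ### Total complexes: from rows to the total map -/

namespace HomologicalComplex₂

open CategoryTheory.Limits

variable {V : Type*} [Category V] [Preadditive V]
  (K : HomologicalComplex₂ V (ComplexShape.down ℕ) (ComplexShape.down ℕ))
  [K.HasTotal (ComplexShape.down ℕ)]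

/-- The projection of the total complex onto one of the summands. -/
noncomputable def totalProj (p q n : ℕ) :
    (K.total (ComplexShape.down ℕ)).X n ⟶ (K.X p).X q :=
  K.totalDesc fun i j _ =>
    if h : i = p ∧ j = q then (K.XXIsoOfEq _ _ _ h.1 h.2).hom else 0

lemma ι_totalProj_self (p q n : ℕ) (h : p + q = n) :
    K.ιTotal (ComplexShape.down ℕ) p q n h ≫ K.totalProj p q n = 𝟙 _ := by
  simp [totalProj]

lemma ι_totalProj_of_ne {i j p q n : ℕ} (h : i + j = n) (hne : ¬ (i = p ∧ j = q)) :
    K.ιTotal (ComplexShape.down ℕ) i j n h ≫ K.totalProj p q n = 0 := by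
  simp [totalProj, hne]

lemma ι_totalProj_self_assoc (p q n : ℕ) (h : p + q = n) {T : V} (t : (K.X p).X q ⟶ T) :
    K.ιTotal (ComplexShape.down ℕ) p q n h ≫ K.totalProj p q n ≫ t = t := by
  rw [← Category.assoc, ι_totalProj_self, Category.id_comp]

lemma ι_totalProj_of_ne_assoc {i j p q n : ℕ} (h : i + j = n) (hne : ¬ (i = p ∧ j = q)) {T : V}
    (t : (K.X p).X q ⟶ T) :
    K.ιTotal (ComplexShape.down ℕ) i j n h ≫ K.totalProj p q n ≫ t = 0 ≫ t := by
  rw [← Category.assoc, ι_totalProj_of_ne K h hne]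

lemma totalProj_eq_zero {p q n : ℕ} (h : p + q ≠ n) : K.totalProj p q n = 0 := by
  apply total.hom_ext
  intro i j hij
  change i + j = n at hij
  rw [ι_totalProj_of_ne _ hij (by rintro ⟨rfl, rfl⟩; exact h hij), comp_zero]

/-- In the first quadrant each antidiagonal is finite, so the identity of the total object is a
finite sum of projections followed by inclusions. -/
lemma eq_zero_of_totalProj {T : V} {n : ℕ} (w : T ⟶ (K.total (ComplexShape.down ℕ)).X n)
    (hw : ∀ p q, w ≫ K.totalProj p q n = 0) : w = 0 := by
  have h : 𝟙 ((K.total (ComplexShape.down ℕ)).X n) =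
      ∑ p : Finset.HasAntidiagonal.antidiagonal n, K.totalProj p.1.1 p.1.2 n ≫
        K.ιTotal (ComplexShape.down ℕ) p.1.1 p.1.2 n
          (Finset.HasAntidiagonal.mem_antidiagonal.1 p.2) := by
    apply total.hom_ext
    intro i j hij
    change i + j = n at hij
    rw [Preadditive.comp_sum,
      Finset.sum_eq_single ⟨(i, j), Finset.HasAntidiagonal.mem_antidiagonal.2 hij⟩,
      ι_totalProj_self_assoc, Category.comp_id]
    · intro p _ hp
      rw [ι_totalProj_of_ne_assoc _ hij (fun h => hp (Subtype.ext (Prod.ext h.1.symm h.2.symm))),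
        zero_comp]
    · simp
  rw [← Category.comp_id w, h, Preadditive.comp_sum]
  exact Finset.sum_eq_zero fun p _ => by rw [reassoc_of% hw, zero_comp]

lemma total_d_totalProj (p q n : ℕ) (h : p + q = n) :
    (K.total (ComplexShape.down ℕ)).d (n + 1) n ≫ K.totalProj p q n =
      K.totalProj (p + 1) q (n + 1) ≫ (K.d (p + 1) p).f q +
        (-1 : ℤˣ) ^ p • K.totalProj p (q + 1) (n + 1) ≫ (K.X p).d (q + 1) q := by
  apply total.hom_ext
  intro i j hij
  change i + j = n + 1 at hij
  rw [total_d, Preadditive.add_comp, Preadditive.comp_add, ι_D₁_assoc, ι_D₂_assoc,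
    Preadditive.comp_add]
  congr 1
  · by_cases hi : i = 0
    · subst hi
      rw [d₁_eq_zero _ _ _ _ _ (by rw [ChainComplex.next_nat_zero]; simp), zero_comp,
        ι_totalProj_of_ne_assoc _ hij (by simp), zero_comp]
    · obtain ⟨i, rfl⟩ := Nat.exists_eq_succ_of_ne_zero hi
      have hij' : i + j = n := by simp at hij; omega
      rw [d₁_eq _ _ (show (ComplexShape.down ℕ).Rel (i + 1) i from rfl) _ _ hij']
      have hε : ComplexShape.ε₁ (ComplexShape.down ℕ) (ComplexShape.down ℕ)
        (ComplexShape.down ℕ) (i + 1, j) = 1 := rfl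
      rw [hε, one_smul, Category.assoc]
      by_cases hp : i = p ∧ j = q
      · obtain ⟨rfl, rfl⟩ := hp
        rw [ι_totalProj_self, ι_totalProj_self_assoc, Category.comp_id]
      · rw [ι_totalProj_of_ne _ hij' hp, ι_totalProj_of_ne_assoc _ hij (by simpa using hp),
          comp_zero, zero_comp]
  · by_cases hj : j = 0
    · subst hj
      rw [d₂_eq_zero _ _ _ _ _ (by rw [ChainComplex.next_nat_zero]; simp), zero_comp,
        Linear.comp_units_smul, ι_totalProj_of_ne_assoc _ hij (by simp), zero_comp, smul_zero]
    · obtain ⟨j, rfl⟩ := Nat.exists_eq_succ_of_ne_zero hj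
      have hij' : i + j = n := by omega
      rw [d₂_eq _ _ _ (show (ComplexShape.down ℕ).Rel (j + 1) j from rfl) _ hij']
      have hε : ComplexShape.ε₂ (ComplexShape.down ℕ) (ComplexShape.down ℕ)
        (ComplexShape.down ℕ) (i, j + 1) = (-1 : ℤˣ) ^ i := rfl
      rw [hε, Linear.units_smul_comp, Category.assoc, Linear.comp_units_smul]
      by_cases hp : i = p ∧ j = q
      · obtain ⟨rfl, rfl⟩ := hp
        rw [ι_totalProj_self, ι_totalProj_self_assoc, Category.comp_id]
      · rw [ι_totalProj_of_ne _ hij' hp, ι_totalProj_of_ne_assoc _ hij (by simpa using hp),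
          comp_zero, zero_comp, smul_zero, smul_zero]

variable {K}
variable {L : HomologicalComplex₂ V (ComplexShape.down ℕ) (ComplexShape.down ℕ)}
  [L.HasTotal (ComplexShape.down ℕ)] (φ : K ⟶ L)

lemma totalMap_totalProj (p q n : ℕ) :
    (total.map φ (ComplexShape.down ℕ)).f n ≫ L.totalProj p q n =
      K.totalProj p q n ≫ (φ.f p).f q := by
  apply total.hom_ext
  intro i j hij
  change i + j = n at hij
  rw [ιTotal_map_assoc]
  by_cases hp : i = p ∧ j = q
  · obtain ⟨rfl, rfl⟩ := hp
    rw [ι_totalProj_self, ι_totalProj_self_assoc, Category.comp_id]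
  · rw [ι_totalProj_of_ne _ hij hp, ι_totalProj_of_ne_assoc _ hij hp, comp_zero, zero_comp]

/-- The vertical differential sends row `k` to the row below, so only the horizontal differential is
visible in rows `k` and above. -/
lemma ι_total_d_totalProj {i k n p q : ℕ} (hik : i + k = n + 1) (hpq : p + q = n) (hkq : k ≤ q) :
    K.ιTotal (ComplexShape.down ℕ) i k (n + 1) hik ≫
      (K.total (ComplexShape.down ℕ)).d (n + 1) n ≫ K.totalProj p q n =
    K.ιTotal (ComplexShape.down ℕ) i k (n + 1) hik ≫
      K.totalProj (p + 1) q (n + 1) ≫ (K.d (p + 1) p).f q := by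
  rw [total_d_totalProj _ _ _ _ hpq, Preadditive.comp_add, Linear.comp_units_smul,
    ι_totalProj_of_ne_assoc K hik (p := p) (q := q + 1) (by omega), zero_comp, smul_zero, add_zero]

/-- A map of first quadrant bicomplexes whose rows have acyclic mapping cones induces a map of total
complexes with the same property. -/
theorem coneExact_total_map
    (hφ : ∀ q, ConeExact (((flipFunctor V _ _).map φ).f q)) :
    ConeExact (total.map φ (ComplexShape.down ℕ)) := by
  have hrow : ∀ q p p' p'' (_ : p - 1 = p') (_ : p' - 1 = p'') {T : V} (x : T ⟶ (K.X p').X q)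
      (w : T ⟶ (L.X p).X q), (p = 0 → x = 0) → x ≫ (K.d p' p'').f q = 0 →
      x ≫ (φ.f p').f q = w ≫ (L.d p p').f q →
      ∃ (x' : T ⟶ (K.X p).X q) (w' : T ⟶ (L.X (p + 1)).X q),
        x' ≫ (K.d p p').f q = x ∧ x' ≫ (φ.f p).f q - w = w' ≫ (L.d (p + 1) p).f q := hφ
  -- Induction on the number `k` of rows, counted from the bottom, that may support the relative
  -- cycle.
  have key : ∀ (k n m l : ℕ) (_ : n - 1 = m) (_ : m - 1 = l) {T : V}
      (x : T ⟶ (K.total (ComplexShape.down ℕ)).X m)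
      (w : T ⟶ (L.total (ComplexShape.down ℕ)).X n), (n = 0 → x = 0) →
      x ≫ (K.total (ComplexShape.down ℕ)).d m l = 0 →
      x ≫ (total.map φ (ComplexShape.down ℕ)).f m = w ≫ (L.total (ComplexShape.down ℕ)).d n m →
      (∀ i j, k ≤ j → x ≫ K.totalProj i j m = 0) →
      (∀ i j, k ≤ j → w ≫ L.totalProj i j n = 0) →
      ∃ (x' : T ⟶ (K.total (ComplexShape.down ℕ)).X n)
        (w' : T ⟶ (L.total (ComplexShape.down ℕ)).X (n + 1)),
        x' ≫ (K.total (ComplexShape.down ℕ)).d n m = x ∧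
        x' ≫ (total.map φ (ComplexShape.down ℕ)).f n - w =
          w' ≫ (L.total (ComplexShape.down ℕ)).d (n + 1) n := by
    intro k
    induction k with
    | zero =>
      intro n m l _ _ T x w _ _ _ hx hw
      exact ⟨0, 0, by simp [eq_zero_of_totalProj _ x fun i j => hx i j j.zero_le],
        by simp [eq_zero_of_totalProj _ w fun i j => hw i j j.zero_le]⟩
    | succ k ih =>
      intro n m l hm hl T x w hx₀ hdx hxw hx hw
      by_cases hkn : n < k
      · refine ih n m l hm hl x w hx₀ hdx hxw (fun i j hj => ?_) (fun i j hj => ?_)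
        · rw [totalProj_eq_zero _ (by omega), comp_zero]
        · rw [totalProj_eq_zero _ (by omega), comp_zero]
      obtain ⟨p, hp⟩ : ∃ p, p + k = n := ⟨n - k, by omega⟩
      obtain ⟨p', hp'⟩ : ∃ p', p - 1 = p' := ⟨_, rfl⟩
      obtain ⟨p'', hp''⟩ : ∃ p'', p' - 1 = p'' := ⟨_, rfl⟩
      have hp₀ : p = 0 → x ≫ K.totalProj p' k m = 0 := by
        intro hp0
        by_cases hn : n = 0
        · rw [hx₀ hn, zero_comp]
        · rw [totalProj_eq_zero _ (by omega), comp_zero]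
      -- Nothing reaches row `k` vertically, since the components in row `k + 1` vanish; hence the
      -- components in the top row `k` form a relative cycle of that row.
      obtain ⟨x', w', hx', hw'⟩ := hrow k p p' p'' hp' hp'' (x ≫ K.totalProj p' k m)
        (w ≫ L.totalProj p k n) hp₀ (by
          by_cases hp2 : p < 2
          · rw [K.shape_f _ _ (by simp; omega), comp_zero]
          · obtain rfl : p' = p'' + 1 := by omega
            obtain rfl : l = p'' + k := by omega
            obtain rfl : m = p'' + k + 1 := by omega
            have h := hdx =≫ K.totalProj p'' k (p'' + k)
            rw [Category.assoc, total_d_totalProj _ _ _ _ rfl, Preadditive.comp_add,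
              Linear.comp_units_smul, reassoc_of% hx p'' (k + 1) le_rfl, zero_comp, smul_zero,
              add_zero, zero_comp] at h
            rw [Category.assoc, h]) (by
          by_cases hp1 : p = 0
          · rw [hp₀ hp1, L.shape_f _ _ (by simp; omega), comp_zero, zero_comp]
          · obtain rfl : p = p' + 1 := by omega
            obtain rfl : m = p' + k := by omega
            obtain rfl : n = p' + k + 1 := by omega
            have h := hxw =≫ L.totalProj p' k (p' + k)
            rw [Category.assoc, Category.assoc, total_d_totalProj _ _ _ _ rfl, Preadditive.comp_add,
              Linear.comp_units_smul, reassoc_of% hw p' (k + 1) le_rfl, zero_comp, smul_zero,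
              add_zero, totalMap_totalProj] at h
            rw [Category.assoc, Category.assoc, h])
      have hp1 : (p + 1) + k = n + 1 := by omega
      -- Subtracting the relative boundary of `(x', w')`, included in the total complexes, cancels
      -- row `k` and changes otherwise only lower rows.
      obtain ⟨x'', w'', hx'', hw''⟩ := ih n m l hm hl
        (x - x' ≫ K.ιTotal (ComplexShape.down ℕ) p k n hp ≫
          (K.total (ComplexShape.down ℕ)).d n m)
        (w - x' ≫ (φ.f p).f k ≫ L.ιTotal (ComplexShape.down ℕ) p k n hp +
          w' ≫ L.ιTotal (ComplexShape.down ℕ) (p + 1) k (n + 1) hp1 ≫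
            (L.total (ComplexShape.down ℕ)).d (n + 1) n)
        (by
          intro hn
          rw [hx₀ hn, HomologicalComplex.shape _ _ _ (by simp; omega), comp_zero, comp_zero,
            sub_zero])
        (by
          rw [Preadditive.sub_comp, hdx, Category.assoc, Category.assoc,
            HomologicalComplex.d_comp_d, comp_zero, comp_zero, sub_zero])
        (by
          rw [Preadditive.sub_comp, Preadditive.add_comp, Preadditive.sub_comp, hxw]
          simp only [Category.assoc, HomologicalComplex.d_comp_d, comp_zero, add_zero]
          rw [← (total.map φ (ComplexShape.down ℕ)).comm, ιTotal_map_assoc])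
        (by
          intro i j hj
          by_cases hn : n = 0
          · rw [hx₀ hn, HomologicalComplex.shape _ _ _ (by simp; omega), comp_zero, comp_zero,
              sub_zero, zero_comp]
          obtain rfl : n = m + 1 := by omega
          by_cases hij : i + j = m
          · simp only [Preadditive.sub_comp, Category.assoc]
            rw [ι_total_d_totalProj _ hij hj]
            by_cases hjk : j = k
            · subst hjk
              obtain rfl : p = i + 1 := by omega
              obtain rfl : i = p' := by omega
              rw [ι_totalProj_self_assoc, ← hx', sub_self]
            · rw [ι_totalProj_of_ne_assoc _ _ (by omega), hx _ _ (by omega), zero_comp,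
                comp_zero, sub_zero]
          · rw [totalProj_eq_zero _ hij, comp_zero])
        (by
          intro i j hj
          by_cases hij : i + j = n
          · simp only [Preadditive.sub_comp, Preadditive.add_comp, Category.assoc]
            rw [ι_total_d_totalProj _ hij hj]
            by_cases hjk : j = k
            · subst hjk
              obtain rfl : p = i := by omega
              rw [ι_totalProj_self, ι_totalProj_self_assoc, ← hw', Category.comp_id]
              abel
            · rw [ι_totalProj_of_ne_assoc _ _ (by omega), ι_totalProj_of_ne _ _ (by omega),
                hw _ _ (by omega)]
              simp
          · rw [totalProj_eq_zero _ hij, comp_zero])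
      refine ⟨x'' + x' ≫ K.ιTotal (ComplexShape.down ℕ) p k n hp,
        w'' + w' ≫ L.ιTotal (ComplexShape.down ℕ) (p + 1) k (n + 1) hp1, ?_, ?_⟩
      · rw [Preadditive.add_comp, hx'', Category.assoc]
        abel
      · rw [Preadditive.add_comp, Preadditive.add_comp, ← hw'', Category.assoc, Category.assoc,
          ιTotal_map]
        abel
  intro n m l hm hl T x w hx₀ hdx hxw
  -- Rows of index above `n` do not meet total degree `n` or `m`, so `n + 1` rows suffice.
  refine key (n + 1) n m l hm hl x w hx₀ hdx hxw (fun i j hj => ?_) (fun i j hj => ?_)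
  · rw [totalProj_eq_zero _ (by omega), comp_zero]
  · rw [totalProj_eq_zero _ (by omega), comp_zero]

end HomologicalComplex₂

/-! ### A weak equivalence as an equivalence of groupoids -/

namespace CrossedModule

variable {H G H' G' : Type u} [Group H] [Group G] [Group H'] [Group G']
  {X : CrossedModule H G} {X' : CrossedModule H' G'}

namespace Hom

variable {φ : Hom X X'}

/-- A weak equivalence is fully faithful as a functor: existence of lifts of arrows. -/
lemma IsWeakEquivalence.exists_lift (hφ : φ.IsWeakEquivalence) {h' : H'} {g₁ g₂ : G}
    (h : X'.μ h' * φ.β g₂ = φ.β g₁) : ∃ k : H, φ.α k = h' ∧ X.μ k * g₂ = g₁ := by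
  have hq : g₁ * g₂⁻¹ ∈ X.μ.range := by
    rw [← QuotientGroup.eq_one_iff]
    apply hφ.2.1
    rw [map_one]
    exact (QuotientGroup.eq_one_iff _).2 ⟨h', by rw [map_mul, map_inv, ← h]; group⟩
  -- `k₀` has the required source and target, but `φ.α k₀` may differ from `h'` by an element of
  -- `Ker μ'`, which surjectivity on kernels absorbs.
  obtain ⟨k₀, hk₀⟩ := hq
  have hker : h' * (φ.α k₀)⁻¹ ∈ X'.μ.ker := by
    rw [MonoidHom.mem_ker, map_mul, map_inv, φ.comm, hk₀, map_mul, ← h, map_inv]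
    group
  obtain ⟨⟨k, hk⟩, hkk⟩ := hφ.1.2 ⟨_, hker⟩
  have hk' : φ.α k = h' * (φ.α k₀)⁻¹ := congrArg Subtype.val hkk
  rw [MonoidHom.mem_ker] at hk
  exact ⟨k * k₀, by rw [map_mul, hk']; group, by rw [map_mul, hk, hk₀]; group⟩

/-- Faithfulness: the quotient of two such elements lies in `Ker μ` and dies in `Ker μ'`. This makes
chosen lifts compatible with composition. -/
lemma IsWeakEquivalence.lift_unique (hφ : φ.IsWeakEquivalence) {k₁ k₂ : H}
    (hα : φ.α k₁ = φ.α k₂) (hμ : X.μ k₁ = X.μ k₂) : k₁ = k₂ := by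
  have hker : k₁ * k₂⁻¹ ∈ X.μ.ker := by rw [MonoidHom.mem_ker, map_mul, map_inv, hμ, mul_inv_cancel]
  have h : (⟨_, hker⟩ : X.μ.ker) = 1 := hφ.1.1 <| Subtype.ext <| by
    rw [map_one]
    change φ.α (k₁ * k₂⁻¹) = 1
    rw [map_mul, map_inv, hα, mul_inv_cancel]
  exact mul_inv_eq_one.1 (congrArg Subtype.val h)

/-- A weak equivalence is essentially surjective as a functor. -/
lemma IsWeakEquivalence.exists_obj (hφ : φ.IsWeakEquivalence) (g' : G') :
    ∃ (g : G) (h' : H'), X'.μ h' * g' = φ.β g := by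
  obtain ⟨q, hq⟩ := hφ.2.2 (QuotientGroup.mk g')
  obtain ⟨g, rfl⟩ := QuotientGroup.mk_surjective q
  have h : (φ.β g)⁻¹ * g' ∈ X'.μ.range := QuotientGroup.eq.1 hq
  obtain ⟨k, hk⟩ := h
  -- Equality of left cosets gives a factor on the right of `φ.β g`; conjugation by `φ.β g` moves it
  -- to the left, where arrows act.
  refine ⟨g, X'.act (φ.β g) k⁻¹, ?_⟩
  rw [X'.map_act, map_inv, hk]
  group

end Hom

namespace Nerve

variable {ι κ : Type}

/-- The simplex obtained from `x` by composing with arrows `(η (x i), x i)` at the vertices `i` in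
the subset `s`. -/
def gauge (η : G → H) (s : ι → Bool) (x : Nerve X ι) : Nerve X ι :=
  let e : ι → H := fun i => if s i then η (x.obj i) else 1
  { obj := fun i => X.μ (e i) * x.obj i
    arr := fun i j => e i * x.arr i j * (e j)⁻¹
    tgt := fun i j => by rw [← x.tgt i j, map_mul, map_mul, map_inv]; group
    comp := fun i j k => by rw [← x.comp i j k]; group }

lemma gauge_false (η : G → H) (x : Nerve X ι) : gauge η (fun _ => false) x = x := by
  ext <;> simp [gauge]

/-- The nerve of a weak equivalence has an inverse, natural in the set of vertices, up to natural
isomorphisms. -/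
lemma exists_inverse {φ : Hom X X'} (hφ : φ.IsWeakEquivalence) :
    ∃ (Ψ : ∀ ι : Type, Nerve X' ι → Nerve X ι) (η' : G' → H') (θ : G → H),
      (∀ (ι κ : Type) (f : κ → ι) x, map f (Ψ ι x) = Ψ κ (map f x)) ∧
      (∀ ι x, ofHom φ ι (Ψ ι x) = gauge η' (fun _ => true) x) ∧
      (∀ ι x, Ψ ι (ofHom φ ι x) = gauge θ (fun _ => true) x) := by
  -- `σ` is the quasi-inverse on objects and `η'` the natural isomorphism from the identity to the
  -- composite on the target; both are mere functions. Its values on arrows, `l`, are lifts of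
  -- conjugates by `η'`, and `θ` is the lift of `η'` giving the other natural isomorphism.
  choose σ η' hσ using hφ.exists_obj
  have hlift : ∀ g₁ g₂ h', X'.μ h' * g₂ = g₁ →
      ∃ k, φ.α k = η' g₁ * h' * (η' g₂)⁻¹ ∧ X.μ k * σ g₂ = σ g₁ := by
    rintro g₁ g₂ h' rfl
    apply hφ.exists_lift
    rw [← hσ, ← hσ]
    simp only [map_mul, map_inv]
    group
  have hθ : ∀ g : G, ∃ k, φ.α k = η' (φ.β g) ∧ X.μ k * g = σ (φ.β g) :=
    fun g => hφ.exists_lift (hσ _)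
  choose l hlα hlμ using hlift
  choose θ hθα hθμ using hθ
  let Ψ (ι : Type) (x : Nerve X' ι) : Nerve X ι :=
    { obj := fun i => σ (x.obj i)
      arr := fun i j => l (x.obj i) (x.obj j) (x.arr i j) (x.tgt i j)
      tgt := fun i j => hlμ _ _ _ _
      comp := fun i j k => by
        apply hφ.lift_unique
        · rw [map_mul, hlα, hlα, hlα, ← x.comp i j k]
          group
        · rw [map_mul, ← mul_left_inj (σ (x.obj k)), mul_assoc, hlμ, hlμ, hlμ] }
  refine ⟨Ψ, η', θ, fun ι κ f x => rfl, fun ι x => ?_, fun ι x => ?_⟩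
  · ext i
    · exact (hσ _).symm
    · exact hlα _ _ _ _
  · ext i j
    · exact (hθμ _).symm
    · apply hφ.lift_unique
      · simp only [gauge, if_true, map_mul, map_inv, hθα]
        exact hlα _ _ _ _
      · rw [← mul_left_inj (σ (φ.β (x.obj j)))]
        refine (hlμ _ _ _ _).trans ?_
        simp only [gauge, if_true, map_mul, map_inv, ofHom, MonoidHom.coe_mk, OneHom.coe_mk]
        rw [← hθμ, ← hθμ, ← x.tgt i j]
        group

end Nerve

end CrossedModule

/-! ### Rows of the bicomplex and simplicial homotopies -/

lemma Fin.val_succAbove_eq_ite {n : ℕ} (i : Fin (n + 1)) (v : Fin n) :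
    (i.succAbove v : ℕ) = if (v : ℕ) < i then (v : ℕ) else v + 1 := by
  rw [Fin.succAbove]
  simp only [Fin.lt_def, Fin.val_castSucc]
  split_ifs <;> rfl

lemma Fin.val_predAbove_eq_ite {n : ℕ} (j : Fin n) (v : Fin (n + 1)) :
    (j.predAbove v : ℕ) = if (j : ℕ) < v then (v : ℕ) - 1 else v := by
  rw [Fin.predAbove]
  simp only [Fin.lt_def, Fin.val_castSucc]
  split_ifs <;> rfl

namespace CrossedModule

open Simplicial

variable {H G H' G' C A : Type u} [Group H] [Group G] [Group H'] [Group G']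
  [AddCommGroup C] [AddCommGroup A] {X : CrossedModule H G} {X' : CrossedModule H' G'}
  {M : AbelianCrossedModule C A}

/-- The linear map on inhomogeneous `q`-chains induced by a map of sets `F` between nerves of crossed
modules and a simplicial operator `f` on the coefficients. -/
noncomputable def chainLin (M : AbelianCrossedModule C A) (q : ℕ) {ι κ : Type}
    (F : Nerve X ι → Nerve X' κ) (f : κ → ι) :
    ((Fin q → Nerve X ι) →₀ M.Nerve ι) →ₗ[ULift.{u} ℤ] ((Fin q → Nerve X' κ) →₀ M.Nerve κ) :=
  Finsupp.mapRange.linearMap (toLin (AbelianCrossedModule.Nerve.map M f)) ∘ₗ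
    Finsupp.lmapDomain (M.Nerve ι) (ULift.{u} ℤ) (F ∘ ·)

lemma chainLin_single (q : ℕ) {ι κ : Type} (F : Nerve X ι → Nerve X' κ) (f : κ → ι)
    (x : Fin q → Nerve X ι) (m : M.Nerve ι) :
    chainLin M q F f (Finsupp.single x m) =
      Finsupp.single (F ∘ x) (AbelianCrossedModule.Nerve.map M f m) := by
  simp only [chainLin, LinearMap.comp_apply, Finsupp.lmapDomain_apply, Finsupp.mapDomain_single,
    Finsupp.mapRange.linearMap_apply, Finsupp.mapRange_single]
  rfl

lemma chainLin_comp {H'' G'' : Type u} [Group H''] [Group G''] {X'' : CrossedModule H'' G''}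
    (q : ℕ) {ι κ τ : Type} (F : Nerve X ι → Nerve X' κ) (f : κ → ι)
    (F' : Nerve X' κ → Nerve X'' τ) (f' : τ → κ) :
    chainLin M q F' f' ∘ₗ chainLin M q F f = chainLin M q (F' ∘ F) (f ∘ f') := by
  apply Finsupp.lhom_ext
  intro x m
  rw [LinearMap.comp_apply, chainLin_single, chainLin_single, chainLin_single]
  rfl

lemma chainLin_id (q : ℕ) (ι : Type) :
    chainLin M q (id : Nerve X ι → Nerve X ι) id = LinearMap.id := by
  apply Finsupp.lhom_ext
  intro x m
  rw [chainLin_single]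
  rfl

namespace Action

/-- The `q`-th row of the bicomplex `B(N, A)` as a simplicial module. -/
noncomputable def row (a : Action X M) (q : ℕ) : SimplicialObject (ModuleCat.{u} (ULift.{u} ℤ)) :=
  ((SimplicialObject.whiskering _ _).obj (HomologicalComplex.eval _ _ q)).obj a.bar

/-- `chainLin` as a morphism between the terms of bar degree `q`. -/
noncomputable def barDegree (a : Action X M) (b : Action X' M) (q : ℕ) {ι κ : Type}
    (F : Nerve X ι → Nerve X' κ) (f : κ → ι) :
    (groupHomology.inhomogeneousChains (a.nerveRep ι)).X q ⟶
      (groupHomology.inhomogeneousChains (b.nerveRep κ)).X q :=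
  ModuleCat.ofHom (chainLin M q F f)

lemma barDegree_comp {H'' G'' : Type u} [Group H''] [Group G''] {X'' : CrossedModule H'' G''}
    (a : Action X M) (b : Action X' M) (c : Action X'' M) (q : ℕ) {ι κ τ : Type}
    (F : Nerve X ι → Nerve X' κ) (f : κ → ι) (F' : Nerve X' κ → Nerve X'' τ) (f' : τ → κ) :
    a.barDegree b q F f ≫ b.barDegree c q F' f' = a.barDegree c q (F' ∘ F) (f ∘ f') :=
  ModuleCat.hom_ext (chainLin_comp q F f F' f')

lemma barDegree_id (a : Action X M) (q : ℕ) (ι : Type) :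
    a.barDegree a q (id : Nerve X ι → Nerve X ι) id = 𝟙 _ :=
  ModuleCat.hom_ext (chainLin_id q ι)

/-- The point at which group laws and actions drop out: in a fixed bar degree the operator is
entrywise on tuples and coefficients. -/
lemma row_map (a : Action X M) (q : ℕ) {m n : SimplexCategoryᵒᵖ} (f : m ⟶ n) :
    (a.row q).map f = a.barDegree a q (Nerve.map f.unop.toOrderHom) f.unop.toOrderHom := rfl

/-- A natural family of maps between nerves induces a map of rows. -/
noncomputable def rowMap (a : Action X M) (b : Action X' M) (q : ℕ)
    (Ψ : ∀ ι : Type, Nerve X ι → Nerve X' ι)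
    (hΨ : ∀ (ι κ : Type) (f : κ → ι) x, Nerve.map f (Ψ ι x) = Ψ κ (Nerve.map f x)) :
    a.row q ⟶ b.row q where
  app n := a.barDegree b q (Ψ (Fin (n.unop.len + 1))) id
  naturality m n f := by
    rw [row_map, row_map]
    refine (barDegree_comp ..).trans (Eq.trans ?_ (barDegree_comp ..).symm)
    congr 1
    funext x
    exact (hΨ _ _ _ _).symm

/-- The composite of a simplicial operator and of the gauge transformation by `η` at the vertices in
`s`, on a row. -/
noncomputable def gaugeOp (a : Action X M) (q : ℕ) (η : G → H) {m n : ℕ}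
    (s : Fin (n + 1) → Bool) (f : Fin (n + 1) → Fin (m + 1)) :
    (a.row q) _⦋m⦌ ⟶ (a.row q) _⦋n⦌ :=
  a.barDegree a q (fun x => Nerve.gauge η s (Nerve.map f x)) f

lemma row_δ (a : Action X M) (q n : ℕ) (i : Fin (n + 2)) :
    (a.row q).δ i = a.barDegree a q (Nerve.map i.succAbove) i.succAbove := rfl

lemma row_σ (a : Action X M) (q n : ℕ) (i : Fin (n + 1)) :
    (a.row q).σ i = a.barDegree a q (Nerve.map i.predAbove) i.predAbove := rfl

lemma gaugeOp_comp_δ (a : Action X M) (q : ℕ) (η : G → H) {m n : ℕ} (s : Fin (n + 2) → Bool)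
    (f : Fin (n + 2) → Fin (m + 1)) (i : Fin (n + 2)) :
    a.gaugeOp q η s f ≫ (a.row q).δ i = a.gaugeOp q η (s ∘ i.succAbove) (f ∘ i.succAbove) := by
  rw [row_δ]
  exact barDegree_comp ..

lemma δ_comp_gaugeOp (a : Action X M) (q : ℕ) (η : G → H) {m n : ℕ} (s : Fin (n + 1) → Bool)
    (f : Fin (n + 1) → Fin (m + 1)) (i : Fin (m + 2)) :
    (a.row q).δ i ≫ a.gaugeOp q η s f = a.gaugeOp q η s (i.succAbove ∘ f) := by
  rw [row_δ]
  exact barDegree_comp ..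

lemma gaugeOp_comp_σ (a : Action X M) (q : ℕ) (η : G → H) {m n : ℕ} (s : Fin (n + 1) → Bool)
    (f : Fin (n + 1) → Fin (m + 1)) (i : Fin (n + 1)) :
    a.gaugeOp q η s f ≫ (a.row q).σ i = a.gaugeOp q η (s ∘ i.predAbove) (f ∘ i.predAbove) := by
  rw [row_σ]
  exact barDegree_comp ..

lemma σ_comp_gaugeOp (a : Action X M) (q : ℕ) (η : G → H) {m n : ℕ} (s : Fin (n + 1) → Bool)
    (f : Fin (n + 1) → Fin (m + 2)) (i : Fin (m + 1)) :
    (a.row q).σ i ≫ a.gaugeOp q η s f = a.gaugeOp q η s (i.predAbove ∘ f) := by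
  rw [row_σ]
  exact barDegree_comp ..

/-- The endomorphism of a row induced by the gauge transformation by `η`. -/
noncomputable def rowGauge (a : Action X M) (q : ℕ) (η : G → H) : a.row q ⟶ a.row q :=
  a.rowMap a q (fun _ => Nerve.gauge η fun _ => true) fun _ _ _ _ => rfl

/-- A gauge transformation is simplicially homotopic to the identity. -/
noncomputable def rowGaugeHomotopy (a : Action X M) (q : ℕ) (η : G → H) :
    SimplicialObject.Homotopy (𝟙 (a.row q)) (a.rowGauge q η) where
  -- The prism operator: vertex `j` is repeated and every vertex after its first copy is moved along
  -- `η`, giving `x₀, …, xⱼ, x'ⱼ, …, x'ₙ` in each entry of the tuple. The coefficient only undergoes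
  -- the degeneracy. The homotopy identities then compare subsets of vertices and index maps.
  h {n} j := a.gaugeOp q η (fun i : Fin (n + 2) => decide (j.castSucc < i)) j.predAbove
  h_zero_comp_δ_zero n := by
    rw [gaugeOp_comp_δ]
    have h₁ : (fun i : Fin (n + 2) => decide ((0 : Fin (n + 1)).castSucc < i)) ∘
        (0 : Fin (n + 2)).succAbove = fun _ => true := by
      funext i; simp
    have h₂ : (0 : Fin (n + 1)).predAbove ∘ (0 : Fin (n + 2)).succAbove = id := by
      funext i; simp
    exact congrArg₂ (a.gaugeOp q η) h₁ h₂
  h_last_comp_δ_last n := by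
    rw [gaugeOp_comp_δ]
    have h₁ : (fun i : Fin (n + 2) => decide ((Fin.last n).castSucc < i)) ∘
        (Fin.last (n + 1)).succAbove = fun _ => false := by
      funext i; simp [Fin.le_last]
    have h₂ : (Fin.last n).predAbove ∘ (Fin.last (n + 1)).succAbove = id := by
      funext i; simp
    refine (congrArg₂ (a.gaugeOp q η) h₁ h₂).trans (Eq.trans ?_ (a.barDegree_id q _))
    exact congrArg (fun T => a.barDegree a q T id) (funext (Nerve.gauge_false η))
  h_succ_comp_δ_castSucc_of_lt {n} i j hij := by
    simp only [Fin.le_def, Fin.val_castSucc] at hij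
    rw [gaugeOp_comp_δ, δ_comp_gaugeOp]
    have h₁ : (fun v : Fin (n + 3) => decide (j.succ.castSucc < v)) ∘ i.castSucc.succAbove =
        fun v : Fin (n + 2) => decide (j.castSucc < v) := by
      funext v
      simp only [Function.comp_apply, decide_eq_decide, Fin.lt_def, Fin.val_succAbove_eq_ite,
        Fin.val_castSucc, Fin.val_succ]
      split_ifs <;> omega
    have h₂ : j.succ.predAbove ∘ i.castSucc.succAbove = i.succAbove ∘ j.predAbove := by
      funext v
      simp only [Function.comp_apply, Fin.ext_iff, Fin.val_succAbove_eq_ite,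
        Fin.val_predAbove_eq_ite, Fin.val_castSucc, Fin.val_succ]
      split_ifs <;> omega
    exact congrArg₂ (a.gaugeOp q η) h₁ h₂
  h_succ_comp_δ_castSucc_succ {n} j := by
    rw [gaugeOp_comp_δ, gaugeOp_comp_δ]
    have h₁ : (fun v : Fin (n + 3) => decide (j.succ.castSucc < v)) ∘ j.castSucc.succ.succAbove =
        (fun v : Fin (n + 3) => decide (j.castSucc.castSucc < v)) ∘ j.castSucc.succ.succAbove := by
      funext v
      simp only [Function.comp_apply, decide_eq_decide, Fin.lt_def, Fin.val_succAbove_eq_ite,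
        Fin.val_castSucc, Fin.val_succ]
      split_ifs <;> omega
    have h₂ : j.succ.predAbove ∘ j.castSucc.succ.succAbove =
        j.castSucc.predAbove ∘ j.castSucc.succ.succAbove := by
      funext v
      simp only [Function.comp_apply, Fin.ext_iff, Fin.val_succAbove_eq_ite,
        Fin.val_predAbove_eq_ite, Fin.val_castSucc, Fin.val_succ]
      split_ifs <;> omega
    exact congrArg₂ (a.gaugeOp q η) h₁ h₂
  h_castSucc_comp_δ_succ_of_lt {n} i j hji := by
    simp only [Fin.lt_def, Fin.val_castSucc] at hji
    rw [gaugeOp_comp_δ, δ_comp_gaugeOp]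
    have h₁ : (fun v : Fin (n + 3) => decide (j.castSucc.castSucc < v)) ∘ i.succ.succAbove =
        fun v : Fin (n + 2) => decide (j.castSucc < v) := by
      funext v
      simp only [Function.comp_apply, decide_eq_decide, Fin.lt_def, Fin.val_succAbove_eq_ite,
        Fin.val_castSucc, Fin.val_succ]
      split_ifs <;> omega
    have h₂ : j.castSucc.predAbove ∘ i.succ.succAbove = i.succAbove ∘ j.predAbove := by
      funext v
      simp only [Function.comp_apply, Fin.ext_iff, Fin.val_succAbove_eq_ite,
        Fin.val_predAbove_eq_ite, Fin.val_castSucc, Fin.val_succ]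
      split_ifs <;> omega
    exact congrArg₂ (a.gaugeOp q η) h₁ h₂
  h_comp_σ_castSucc_of_le {n} i j hij := by
    simp only [Fin.le_def] at hij
    rw [gaugeOp_comp_σ, σ_comp_gaugeOp]
    have h₁ : (fun v : Fin (n + 2) => decide (j.castSucc < v)) ∘ i.castSucc.predAbove =
        fun v : Fin (n + 3) => decide (j.succ.castSucc < v) := by
      funext v
      simp only [Function.comp_apply, decide_eq_decide, Fin.lt_def,
        Fin.val_predAbove_eq_ite, Fin.val_castSucc, Fin.val_succ]
      split_ifs <;> omega
    have h₂ : j.predAbove ∘ i.castSucc.predAbove = i.predAbove ∘ j.succ.predAbove := by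
      funext v
      simp only [Function.comp_apply, Fin.ext_iff,
        Fin.val_predAbove_eq_ite, Fin.val_castSucc, Fin.val_succ]
      split_ifs <;> omega
    exact congrArg₂ (a.gaugeOp q η) h₁ h₂
  h_comp_σ_succ_of_lt {n} i j hji := by
    simp only [Fin.le_def] at hji
    rw [gaugeOp_comp_σ, σ_comp_gaugeOp]
    have h₁ : (fun v : Fin (n + 2) => decide (j.castSucc < v)) ∘ i.succ.predAbove =
        fun v : Fin (n + 3) => decide (j.castSucc.castSucc < v) := by
      funext v
      simp only [Function.comp_apply, decide_eq_decide, Fin.lt_def,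
        Fin.val_predAbove_eq_ite, Fin.val_castSucc, Fin.val_succ]
      split_ifs <;> omega
    have h₂ : j.predAbove ∘ i.succ.predAbove = i.predAbove ∘ j.castSucc.predAbove := by
      funext v
      simp only [Function.comp_apply, Fin.ext_iff,
        Fin.val_predAbove_eq_ite, Fin.val_castSucc, Fin.val_succ]
      split_ifs <;> omega
    exact congrArg₂ (a.gaugeOp q η) h₁ h₂

/-- Both composites with the quasi-inverse are gauge transformations, hence homotopic to identities.
Recording `e.hom` lets exactness be transferred to the actual induced map. -/
lemma exists_rowHomotopyEquiv (a : Action X' M) {φ : Hom X X'} (hφ : φ.IsWeakEquivalence) (q : ℕ) :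
    ∃ e : HomotopyEquiv
        ((AlgebraicTopology.alternatingFaceMapComplex _).obj ((a.pullback φ).row q))
        ((AlgebraicTopology.alternatingFaceMapComplex _).obj (a.row q)),
      e.hom = (AlgebraicTopology.alternatingFaceMapComplex _).map
        (((SimplicialObject.whiskering _ _).obj (HomologicalComplex.eval _ _ q)).map
          (a.barMap φ)) := by
  obtain ⟨Ψ, η', θ, hΨ, hη', hθ⟩ := Nerve.exists_inverse hφ
  let F : (a.pullback φ).row q ⟶ a.row q :=
    ((SimplicialObject.whiskering _ _).obj (HomologicalComplex.eval _ _ q)).map (a.barMap φ)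
  let P : a.row q ⟶ (a.pullback φ).row q := a.rowMap (a.pullback φ) q Ψ hΨ
  have hFP : F ≫ P = (a.pullback φ).rowGauge q θ := by
    refine SimplicialObject.hom_ext _ _ fun n => ?_
    refine (barDegree_comp ..).trans ?_
    exact congrArg (fun T => (a.pullback φ).barDegree (a.pullback φ) q T id) (funext (hθ _))
  have hPF : P ≫ F = a.rowGauge q η' := by
    refine SimplicialObject.hom_ext _ _ fun n => ?_
    refine (barDegree_comp ..).trans ?_
    exact congrArg (fun T => a.barDegree a q T id) (funext (hη' _))
  refine ⟨⟨(AlgebraicTopology.alternatingFaceMapComplex _).map F,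
    (AlgebraicTopology.alternatingFaceMapComplex _).map P, ?_, ?_⟩, rfl⟩
  · refine (Homotopy.ofEq ?_).trans
      ((((a.pullback φ).rowGaugeHomotopy q θ).toChainHomotopy.symm).trans (Homotopy.ofEq ?_))
    · rw [← Functor.map_comp, hFP]
    · exact CategoryTheory.Functor.map_id ..
  · refine (Homotopy.ofEq ?_).trans
      (((a.rowGaugeHomotopy q η').toChainHomotopy.symm).trans (Homotopy.ofEq ?_))
    · rw [← Functor.map_comp, hPF]
    · exact CategoryTheory.Functor.map_id ..

lemma coneExact_row (a : Action X' M) {φ : Hom X X'} (hφ : φ.IsWeakEquivalence) (q : ℕ) :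
    ConeExact (((HomologicalComplex₂.flipFunctor _ _ _).map (a.bicomplexMap φ)).f q) := by
  obtain ⟨e, he⟩ := a.exists_rowHomotopyEquiv hφ q
  have h := coneExact_of_homotopyEquiv e
  rw [he] at h
  change ConeExact ((AlgebraicTopology.alternatingFaceMapComplex _ ⋙
    (HomologicalComplex.eval (ModuleCat.{u} (ULift.{u} ℤ)) (ComplexShape.down ℕ)
      q).mapHomologicalComplex (ComplexShape.down ℕ)).map (a.barMap φ))
  -- Evaluation in bar degree `q` is additive, so it commutes with alternating sums of faces; this
  -- identifies the flipped bicomplex map in degree `q` with the map of row complexes.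
  rw [AlgebraicTopology.map_alternatingFaceMapComplex]
  exact h

end Action

end CrossedModule

theorem proposition6 {H G H' G' C A : Type u} [Group H] [Group G] [Group H'] [Group G']
    [AddCommGroup C] [AddCommGroup A] {X : CrossedModule H G} {X' : CrossedModule H' G'}
    (φ : CrossedModule.Hom X X') (hφ : φ.IsWeakEquivalence)
    {M : AbelianCrossedModule C A} (a : CrossedModule.Action X' M) (n : ℕ) :
    ∃ e : (a.pullback φ).homology n ≃+ a.homology n, ∀ x, e x = a.homologyMap φ n x := by
  have h : ConeExact (a.totMap φ) :=
    HomologicalComplex₂.coneExact_total_map (a.bicomplexMap φ) fun q => a.coneExact_row hφ q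
  have := h.isIso_homologyMap n
  exact ⟨(asIso (HomologicalComplex.homologyMap (a.totMap φ) n)).toLinearEquiv.toAddEquiv,
    fun _ => rfl⟩
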